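/- Let $\mathcal K^1\subseteq\mathbb R^{n_1}$ and $\mathcal K^2\subseteq\mathbb R^{n_2}$ be nonempty closed convex cones with $\mathcal K^2$ polyhedral (i.e. of the form $\{x : \langle a_i,x\rangle\ge 0,\ i=1,\dots,k\}$ for finitely many vectors $a_i\in\mathbb R^{n_2}$), and let $\mathcal K=\mathcal K^1\times\mathcal K^2\subseteq\mathbb R^n$, $n=n_1+n_2$. Let $\mathcal A:\mathbb R^n\to\mathbb R^m$ be linear with adjoint $\mathcal A^T$, let $b\in\mathbb R^m$ and $c\in\mathbb R^n$, and let $\mathcal K^*=\{s\in\mathbb R^n:\langle s,x\rangle\ge 0\ \text{for all } x\in\mathcal K\}$ be the dual cone (and likewise $(\mathcal K^1)^*\subseteq\mathbb R^{n_1}$). Consider the pair of conic linear programs $$\text{(P)}\quad \theta_P=\inf_x\{\langle c,x\rangle : \mathcal A x=b,\ x\in\mathcal K^*\},\qquad \text{(D)}\quad \theta_D=\sup_y\{\langle b,y\rangle : c-\mathcal A^T y\in\mathcal K\},$$ with optimal values in $[-\infty,+\infty]$, where $\theta_P=+\infty$ if (P) is infeasible and $\theta_D=-\infty$ if (D) is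 infeasible. Write $\operatorname{ri}$ for the relative interior. (i) If $\theta_P$ is finite and (P) has a feasible solution $x=(x_1,x_2)\in\mathbb R^{n_1}\times\mathbb R^{n_2}$ with $x_1\in\operatorname{ri}\,(\mathcal K^1)^*$, then $\theta_P=\theta_D$ and the optimal value of (D) is attained, i.e. there is a feasible $y$ of (D) with $\langle b,y\rangle=\theta_D$. (ii) If $\theta_D$ is finite and there is $y\in\mathbb R^m$ whose slack $(s_1,s_2)=c-\mathcal A^T y$ satisfies $s_1\in\operatorname{ri}\,\mathcal K^1$ and $s_2\in\mathcal K^2$, then $\theta_P=\theta_D$ and the optimal value of (P) is attained, i.e. there is a feasible $x$ of (P) with $\langle c,x\rangle=\theta_P$. -/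

import Mathlib

open scoped RealInnerProductSpace

/-- The product `K₁ × K₂` of two (nonempty) closed convex cones, as a closed convex cone in the
Euclidean product `E₁ × E₂`, whose inner product is `⟪x₁, y₁⟫ + ⟪x₂, y₂⟫`. -/
def prodCone {E₁ E₂ : Type*} [NormedAddCommGroup E₁] [InnerProductSpace ℝ E₁]
    [NormedAddCommGroup E₂] [InnerProductSpace ℝ E₂]
    (K₁ : ProperCone ℝ E₁) (K₂ : ProperCone ℝ E₂) : ProperCone ℝ (WithLp 2 (E₁ × E₂)) where
  carrier := {x | x.fst ∈ K₁ ∧ x.snd ∈ K₂}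
  zero_mem' := ⟨K₁.zero_mem, K₂.zero_mem⟩
  add_mem' hx hy := ⟨K₁.add_mem hx.1 hy.1, K₂.add_mem hx.2 hy.2⟩
  smul_mem' r _ hx := ⟨K₁.smul_mem hx.1 r.2, K₂.smul_mem hx.2 r.2⟩
  isClosed' := (K₁.isClosed.preimage (WithLp.prod_continuous_ofLp 2 E₁ E₂).fst).inter
    (K₂.isClosed.preimage (WithLp.prod_continuous_ofLp 2 E₁ E₂).snd)

/-- A cone is polyhedral if it is an intersection of finitely many closed half-spaces
`{x | 0 ≤ ⟪a, x⟫}`, i.e. the dual of a finite set with respect to the inner product. -/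
def IsPolyhedralCone {E : Type*} [NormedAddCommGroup E] [InnerProductSpace ℝ E]
    (K : ProperCone ℝ E) : Prop :=
  K.toPointedCone.DualFG (innerₗ E)

/-- The data of a primal-dual pair of conic linear programs
(P): `inf ⟪c, x⟫` subject to `A x = b`, `x ∈ K*`, and
(D): `sup ⟪b, y⟫` subject to `c - Aᵀ y ∈ K`. -/
structure ConicLP (E F : Type*) [NormedAddCommGroup E] [InnerProductSpace ℝ E]
    [NormedAddCommGroup F] [InnerProductSpace ℝ F] where
  /-- the closed convex cone -/
  K : ProperCone ℝ E
  /-- the linear map -/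
  A : E →ₗ[ℝ] F
  /-- the right-hand side -/
  b : F
  /-- the cost vector -/
  c : E

namespace ConicLP

section

variable {E F : Type*} [NormedAddCommGroup E] [InnerProductSpace ℝ E] [FiniteDimensional ℝ E]
  [NormedAddCommGroup F] [InnerProductSpace ℝ F] [FiniteDimensional ℝ F]

/-- The feasible solutions of (P): `A x = b` and `x` lies in the dual cone `K*`. -/
def primalFeasible (P : ConicLP E F) : Set E :=
  haveI : CompleteSpace E := FiniteDimensional.complete ℝ E
  {x | P.A x = P.b ∧ x ∈ ProperCone.innerDual (P.K : Set E)}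

/-- The slack `c - Aᵀ y`, where `Aᵀ` is the adjoint of `A`. -/
noncomputable def slack (P : ConicLP E F) (y : F) : E :=
  P.c - LinearMap.adjoint P.A y

/-- The feasible solutions of (D): the slack lies in `K`. -/
def dualFeasible (P : ConicLP E F) : Set F :=
  {y | P.slack y ∈ P.K}

/-- The optimal value of (P) in `[-∞, +∞]`; it is `+∞` if (P) is infeasible. -/
noncomputable def primalValue (P : ConicLP E F) : EReal :=
  ⨅ x ∈ P.primalFeasible, ((⟪P.c, x⟫ : ℝ) : EReal)

/-- The optimal value of (D) in `[-∞, +∞]`; it is `-∞` if (D) is infeasible. -/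
noncomputable def dualValue (P : ConicLP E F) : EReal :=
  ⨆ y ∈ P.dualFeasible, ((⟪P.b, y⟫ : ℝ) : EReal)

/-- The primal optimal value is attained. -/
def PrimalAttained (P : ConicLP E F) : Prop :=
  ∃ x ∈ P.primalFeasible, ((⟪P.c, x⟫ : ℝ) : EReal) = P.primalValue

/-- The dual optimal value is attained. -/
def DualAttained (P : ConicLP E F) : Prop :=
  ∃ y ∈ P.dualFeasible, ((⟪P.b, y⟫ : ℝ) : EReal) = P.dualValue

end

section

variable {E₁ E₂ F : Type*} [NormedAddCommGroup E₁] [InnerProductSpace ℝ E₁]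
  [FiniteDimensional ℝ E₁] [NormedAddCommGroup E₂] [InnerProductSpace ℝ E₂]
  [FiniteDimensional ℝ E₂] [NormedAddCommGroup F] [InnerProductSpace ℝ F]
  [FiniteDimensional ℝ F]

/-- The conic linear program over the product cone `K₁ × K₂`. -/
def ofProd (K₁ : ProperCone ℝ E₁) (K₂ : ProperCone ℝ E₂) (A : WithLp 2 (E₁ × E₂) →ₗ[ℝ] F)
    (b : F) (c : WithLp 2 (E₁ × E₂)) : ConicLP (WithLp 2 (E₁ × E₂)) F where
  K := prodCone K₁ K₂
  A := A
  b := b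
  c := c

/-- The partial polyhedral Slater condition for (P) with respect to the block `K₁`: there is a
primal feasible `x = (x₁, x₂)` with `x₁` in the relative interior of `K₁*`. -/
def PrimalPPS (P : ConicLP (WithLp 2 (E₁ × E₂)) F) (K₁ : ProperCone ℝ E₁) : Prop :=
  haveI : CompleteSpace E₁ := FiniteDimensional.complete ℝ E₁
  ∃ x ∈ P.primalFeasible,
    x.fst ∈ intrinsicInterior ℝ (ProperCone.innerDual (K₁ : Set E₁) : Set E₁)

/-- The partial polyhedral Slater condition for (D) with respect to the blocks `K₁`, `K₂`: there
is a slack `(s₁, s₂) = c - Aᵀ y` with `s₁` in the relative interior of `K₁` and `s₂ ∈ K₂`. -/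
def DualPPS (P : ConicLP (WithLp 2 (E₁ × E₂)) F) (K₁ : ProperCone ℝ E₁)
    (K₂ : ProperCone ℝ E₂) : Prop :=
  ∃ y : F, (P.slack y).fst ∈ intrinsicInterior ℝ (K₁ : Set E₁) ∧ (P.slack y).snd ∈ K₂

end

end ConicLP

/-! Both parts apply one Farkas lemma, `mem_map_innerDual_sup`, to a cone `T(C*) + N` with `N`
finitely generated. Farkas needs this cone closed, which may fail for a general `C`. Here a
functional `w`, nonnegative on `N`, restricts to `C*` as pairing with a point `x ∈ ri C`. Let `V =
span C`. Then `C*` is the sum of `C* ∩ V` and `Vᗮ`; the slices `⟪x, s⟫ ≤ B` of `C* ∩ V` are compact,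
and `T(Vᗮ) + N` is finitely generated, hence closed. Each sublevel set of `w` in the cone therefore
lies in a compact set plus a closed cone, itself contained in the cone, and closedness follows.

For (i), take `C = K₁*` and test whether `(c, θ)` lies in the cone of vectors `(s + Aᵀ y, ⟪b, y⟫ -
τ)` with `s ∈ K₁ × K₂`, `τ ≥ 0`. For (ii), take `C = K₁` and test `(b, θ)` against the vectors `(A
x, ⟪c, x⟫ + τ)` with `x ∈ K*`, `τ ≥ 0`. The Slater point supplies `w`, and polyhedrality of `K₂`
makes both `K₂` and `K₂*` finitely generated. Nonnegative functionals are homogenized feasible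
points of the opposite problem, so finiteness of `θ` gives the Farkas hypothesis. Membership yields
a feasible point of value at least (at most) `θ`, and weak duality concludes. -/

namespace PointedCone

/-! ### Finitely generated cones: half-space descriptions and closedness. -/

section FourierMotzkin

variable {H : Type*} [AddCommGroup H] [Module ℝ H]

/-- **Fourier–Motzkin elimination**: the sum of a polyhedral cone and a ray is polyhedral. -/
theorem exists_finite_halfspaces_add_ray {Φ : Set (H →ₗ[ℝ] ℝ)} (hΦ : Φ.Finite) (a : H) :
    ∃ Ψ : Set (H →ₗ[ℝ] ℝ), Ψ.Finite ∧ ∀ x : H, (∀ ψ ∈ Ψ, 0 ≤ ψ x) ↔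
      ∃ t : ℝ, 0 ≤ t ∧ ∀ φ ∈ Φ, 0 ≤ φ (x - t • a) := by
  -- A constraint with `φ a < 0` bounds `t` from below, one with `φ a > 0` from above. The new
  -- functionals compare the upper bounds with `0` and with each lower bound; the combinations
  -- vanish at `a`.
  refine ⟨{φ ∈ Φ | 0 ≤ φ a} ∪ Set.image2 (fun φ χ => φ a • χ - χ a • φ)
    {φ ∈ Φ | 0 ≤ φ a} {φ ∈ Φ | φ a < 0},
    (hΦ.sep _).union ((hΦ.sep _).image2 _ (hΦ.sep _)), fun x => ⟨fun h => ?_, ?_⟩⟩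
  · by_cases hne : {φ ∈ Φ | φ a < 0}.Nonempty
    · obtain ⟨χ, ⟨hχΦ, hχ⟩, hmax⟩ :=
        Set.exists_max_image _ (fun χ : H →ₗ[ℝ] ℝ => χ x / χ a) (hΦ.sep fun φ => φ a < 0) hne
      -- The largest lower bound on `t`.
      refine ⟨max 0 (χ x / χ a), le_max_left _ _, fun φ hφ => ?_⟩
      rw [map_sub, map_smul, smul_eq_mul, sub_nonneg]
      rcases lt_or_ge (φ a) 0 with hneg | hpos
      · have h1 : φ x / φ a ≤ max 0 (χ x / χ a) := (hmax φ ⟨hφ, hneg⟩).trans (le_max_right _ _)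
        rwa [div_le_iff_of_neg hneg] at h1
      · rcases max_choice 0 (χ x / χ a) with hm | hm <;> rw [hm]
        · simpa using h φ (Or.inl ⟨hφ, hpos⟩)
        · have h1 := h _ (Or.inr ⟨φ, ⟨hφ, hpos⟩, χ, ⟨hχΦ, hχ⟩, rfl⟩)
          simp only [LinearMap.sub_apply, LinearMap.smul_apply, smul_eq_mul, sub_nonneg] at h1
          rw [div_mul_eq_mul_div, div_le_iff_of_neg hχ]
          linarith
    · refine ⟨0, le_rfl, fun φ hφ => ?_⟩
      rw [zero_smul, sub_zero]
      refine h φ (Or.inl ⟨hφ, le_of_not_gt fun hneg => hne ⟨φ, hφ, hneg⟩⟩)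
  · rintro ⟨t, ht, h⟩ ψ (⟨hψ, hpos⟩ | ⟨φ, ⟨hφ, hpos⟩, χ, ⟨hχΦ, hχ⟩, rfl⟩)
    · have := h ψ hψ
      rw [map_sub, map_smul, smul_eq_mul] at this
      nlinarith
    · have h1 := h φ hφ
      have h2 := h χ hχΦ
      rw [map_sub, map_smul, smul_eq_mul] at h1 h2
      simp only [LinearMap.sub_apply, LinearMap.smul_apply, smul_eq_mul]
      nlinarith

/-- A finitely generated cone is a finite intersection of half-spaces. -/
theorem exists_finite_halfspaces_of_fg [FiniteDimensional ℝ H] {N : PointedCone ℝ H} (hN : N.FG) :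
    ∃ Φ : Set (H →ₗ[ℝ] ℝ), Φ.Finite ∧ ∀ x, x ∈ N ↔ ∀ φ ∈ Φ, 0 ≤ φ x := by
  classical
  obtain ⟨s, rfl⟩ := hN
  induction s using Finset.induction_on with
  | empty =>
    let B := Module.finBasis ℝ H
    refine ⟨Set.range B.coord ∪ Set.range fun i => -B.coord i,
      (Set.finite_range _).union (Set.finite_range _), fun x => ?_⟩
    simp only [Finset.coe_empty, Submodule.span_empty, Submodule.mem_bot]
    refine ⟨by rintro rfl; simp, fun h => ?_⟩
    refine B.ext_elem fun i => ?_
    have h1 := h _ (Or.inl ⟨i, rfl⟩)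
    have h2 := h _ (Or.inr ⟨i, rfl⟩)
    simp only [LinearMap.neg_apply, Module.Basis.coord_apply] at h1 h2
    simp only [map_zero, Finsupp.coe_zero, Pi.zero_apply]
    linarith
  | insert a s _ ih =>
    obtain ⟨Φ, hΦ, h⟩ := ih
    obtain ⟨Ψ, hΨ, h'⟩ := exists_finite_halfspaces_add_ray hΦ a
    refine ⟨Ψ, hΨ, fun x => ?_⟩
    rw [h', Finset.coe_insert, Submodule.mem_span_insert]
    simp_rw [← h]
    constructor
    · rintro ⟨t, z, hz, rfl⟩
      refine ⟨t, t.2, ?_⟩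
      convert! hz using 1
      exact add_sub_cancel_left (t • a) z
    · rintro ⟨t, ht, hz⟩
      exact ⟨⟨t, ht⟩, _, hz, (add_sub_cancel (t • a) x).symm⟩

end FourierMotzkin

theorem isClosed_of_fg {H : Type*} [NormedAddCommGroup H] [NormedSpace ℝ H] [FiniteDimensional ℝ H]
    {N : PointedCone ℝ H} (hN : N.FG) : IsClosed (N : Set H) := by
  obtain ⟨Φ, -, h⟩ := exists_finite_halfspaces_of_fg hN
  have : (N : Set H) = ⋂ φ ∈ Φ, {x | 0 ≤ φ x} := by
    ext x; simp [h]
  rw [this]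
  exact isClosed_biInter fun φ _ =>
    isClosed_le continuous_const φ.continuous_of_finiteDimensional

/-- The reals are finitely generated over the nonnegative reals. -/
theorem finite_nonneg_real : Module.Finite {c : ℝ // 0 ≤ c} ℝ := by
  refine ⟨⟨{1, -1}, eq_top_iff.2 fun x _ => ?_⟩⟩
  rw [Finset.coe_pair, Submodule.mem_span_pair]
  rcases le_total 0 x with hx | hx
  · exact ⟨⟨x, hx⟩, 0, by simp [Nonneg.mk_smul]⟩
  · exact ⟨0, ⟨-x, neg_nonneg.2 hx⟩, by simp [Nonneg.mk_smul]⟩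

/-- A linear subspace of finite dimension is finitely generated as a cone. -/
theorem fg_ofSubmodule {H : Type*} [AddCommGroup H] [Module ℝ H] [FiniteDimensional ℝ H]
    (V : Submodule ℝ H) : (V : PointedCone ℝ H).FG :=
  haveI := finite_nonneg_real
  Submodule.FG.restrictScalars (IsNoetherian.noetherian V)

theorem fg_map {H H' : Type*} [AddCommGroup H] [Module ℝ H] [AddCommGroup H'] [Module ℝ H']
    {N : PointedCone ℝ H} (hN : N.FG) (f : H →ₗ[ℝ] H') : (N.map f).FG :=
  Submodule.FG.map _ hN

end PointedCone

/-! ### Minkowski–Weyl and compact slices of dual cones. -/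

namespace ProperCone

variable {E : Type*} [NormedAddCommGroup E] [InnerProductSpace ℝ E]

/-- Around a point of the relative interior, a cone contains a ball of its linear span. -/
theorem exists_ball_of_mem_intrinsicInterior (C : ProperCone ℝ E) {x : E}
    (hx : x ∈ intrinsicInterior ℝ (C : Set E)) :
    ∃ ε > 0, ∀ v ∈ Submodule.span ℝ (C : Set E), ‖v‖ < ε → x + v ∈ C := by
  obtain ⟨y, hy, rfl⟩ := mem_intrinsicInterior.1 hx
  obtain ⟨ε, hε, hball⟩ := Metric.mem_nhds_iff.1 (mem_interior_iff_mem_nhds.1 hy)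
  refine ⟨ε, hε, fun v hv hvε => ?_⟩
  have hv' : v ∈ (affineSpan ℝ (C : Set E)).direction := by
    -- Since `0 ∈ C`, the direction of the affine span is the linear span.
    rw [direction_affineSpan, vectorSpan_eq_span_vsub_set_right ℝ (s := (C : Set E)) C.zero_mem]
    simpa using hv
  have hmem : v +ᵥ (y : E) ∈ affineSpan ℝ (C : Set E) :=
    AffineSubspace.vadd_mem_of_mem_direction hv' y.2
  have := @hball ⟨_, hmem⟩ (by
    rw [Metric.mem_ball, Subtype.dist_eq, dist_eq_norm]
    simpa using hvε)
  rw [add_comm]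
  exact this

variable [FiniteDimensional ℝ E]

/-- **Minkowski–Weyl**: the dual of a finite set is a finitely generated cone. -/
theorem fg_innerDual_of_finite [CompleteSpace E] {s : Set E} (hs : s.Finite) :
    (innerDual s).toPointedCone.FG := by
  have hN : (PointedCone.hull ℝ s).FG := Submodule.fg_span hs
  obtain ⟨Φ, hΦ, h⟩ := PointedCone.exists_finite_halfspaces_of_fg hN
  let r : (E →ₗ[ℝ] ℝ) → E := fun φ =>
    (InnerProductSpace.toDual ℝ E).symm (LinearMap.toContinuousLinearMap φ)
  have hr : ∀ φ x, ⟪r φ, x⟫ = φ x := fun φ x => by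
    simp [r, InnerProductSpace.toDual_symm_apply]
  have hN' : (PointedCone.hull ℝ (r '' Φ)).FG := Submodule.fg_span (hΦ.image r)
  let D : ProperCone ℝ E := ⟨PointedCone.hull ℝ (r '' Φ), PointedCone.isClosed_of_fg hN'⟩
  -- The half-space description says that the hull of `s` is the dual of `D`; the bipolar theorem
  -- then identifies `D` with the dual of `s`.
  have hD : innerDual s = D := by
    rw [← innerDual_innerDual D]
    have h1 : (innerDual (D : Set E) : Set E) = PointedCone.hull ℝ s := by
      ext x
      rw [SetLike.mem_coe, SetLike.mem_coe, h]
      constructor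
      · intro hx φ hφ
        rw [← hr]
        exact hx (Submodule.subset_span ⟨φ, hφ, rfl⟩)
      · intro hx
        have : PointedCone.hull ℝ (r '' Φ) ≤ PointedCone.dual (innerₗ E) {x} := by
          rw [Submodule.span_le]
          rintro _ ⟨φ, hφ, rfl⟩
          rintro _ rfl
          change 0 ≤ ⟪_, r φ⟫
          rw [real_inner_comm, hr]
          exact hx φ hφ
        intro y hy
        simpa [real_inner_comm] using this hy
    rw [h1]
    ext y
    exact SetLike.ext_iff.1 (PointedCone.dual_hull (p := innerₗ E) s).symm y
  rw [hD]
  exact hN'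

/-- The slices of the dual cone inside the span of the cone, cut out by a relative interior point,
are compact. -/
theorem isCompact_innerDual_slice [CompleteSpace E] (C : ProperCone ℝ E) {x : E}
    (hx : x ∈ intrinsicInterior ℝ (C : Set E)) (B : ℝ) :
    IsCompact {s | s ∈ innerDual (C : Set E) ∧ s ∈ Submodule.span ℝ (C : Set E) ∧ ⟪x, s⟫ ≤ B} := by
  obtain ⟨ε, hε, h⟩ := C.exists_ball_of_mem_intrinsicInterior hx
  refine Metric.isCompact_of_isClosed_isBounded ?_ ?_
  · exact (innerDual (C : Set E)).isClosed.inter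
      ((Submodule.closed_of_finiteDimensional _).inter
        (isClosed_le (f := fun s : E => ⟪x, s⟫) (by fun_prop) continuous_const))
  · refine (Metric.isBounded_closedBall (x := (0 : E)) (r := 2 * B / ε)).subset ?_
    rintro s ⟨hs, hsV, hsB⟩
    rw [mem_closedBall_zero_iff]
    rcases eq_or_ne s 0 with rfl | hs0
    · rw [inner_zero_right] at hsB
      rw [norm_zero]
      positivity
    have hn : 0 < ‖s‖ := norm_pos_iff.2 hs0
    -- Moving from `x` by `ε / 2` against `s` stays in `C`; pairing with `s` gives `ε * ‖s‖ / 2 ≤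
    -- ⟪x, s⟫ ≤ B`.
    have hmem : x + (-(ε / (2 * ‖s‖))) • s ∈ C := by
      refine h _ (Submodule.smul_mem _ _ hsV) ?_
      rw [norm_smul, norm_neg, Real.norm_of_nonneg (by positivity)]
      field_simp
      linarith
    have h0 := hs hmem
    change 0 ≤ ⟪x + (-(ε / (2 * ‖s‖))) • s, s⟫ at h0
    rw [inner_add_left, real_inner_smul_left, real_inner_self_eq_norm_sq] at h0
    have h1 : -(ε / (2 * ‖s‖)) * ‖s‖ ^ 2 = -(ε * ‖s‖ / 2) := by field_simp
    rw [le_div_iff₀ hε]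
    linarith

/-! ### Closedness of the sum and Farkas' lemma. -/

section Sum

open scoped Pointwise

variable {H : Type*} [NormedAddCommGroup H] [NormedSpace ℝ H] [FiniteDimensional ℝ H]
  [CompleteSpace E]

/-- The sum of a linear image of a dual cone `C*` and a finitely generated cone `N` is closed if
some functional is nonnegative on `N` and restricts on the image to a relative interior point
of `C`. -/
theorem isClosed_map_innerDual_sup (C : ProperCone ℝ E) (T : E →ₗ[ℝ] H) {N : PointedCone ℝ H}
    (hN : N.FG) {x : E} (hx : x ∈ intrinsicInterior ℝ (C : Set E)) (w : H →ₗ[ℝ] ℝ)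
    (hwT : ∀ s, w (T s) = ⟪x, s⟫) (hwN : ∀ n ∈ N, 0 ≤ w n) :
    IsClosed (((innerDual (C : Set E)).toPointedCone.map T ⊔ N : PointedCone ℝ H) : Set H) := by
  let V : Submodule ℝ E := Submodule.span ℝ (C : Set E)
  have hxV : x ∈ V := Submodule.subset_span (intrinsicInterior_subset hx)
  have hdual : ∀ v ∈ Vᗮ, ∀ s ∈ innerDual (C : Set E), s + v ∈ innerDual (C : Set E) := by
    intro v hv s hs y hy
    have := hs hy
    have h0 : ⟪y, v⟫ = 0 := hv y (Submodule.subset_span hy)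
    change 0 ≤ ⟪y, s + v⟫
    rw [inner_add_right, h0, add_zero]
    exact this
  -- The directions `Vᗮ`, along which slices of `C*` are unbounded, are moved into the finitely
  -- generated part.
  let N' : PointedCone ℝ H := (Vᗮ : PointedCone ℝ E).map T ⊔ N
  have hN' : IsClosed (N' : Set H) :=
    PointedCone.isClosed_of_fg
      (Submodule.FG.sup (PointedCone.fg_map (PointedCone.fg_ofSubmodule _) T) hN)
  let K : ℝ → Set E := fun B => {s | s ∈ innerDual (C : Set E) ∧ s ∈ V ∧ ⟪x, s⟫ ≤ B}
  have hK : ∀ B, IsClosed (T '' K B + (N' : Set H)) := fun B =>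
    hN'.add_left_of_isCompact
      ((C.isCompact_innerDual_slice hx B).image T.continuous_of_finiteDimensional)
  set S : PointedCone ℝ H := (innerDual (C : Set E)).toPointedCone.map T ⊔ N with hS
  have hsub : ∀ B, T '' K B + (N' : Set H) ⊆ S := by
    rintro B _ ⟨_, ⟨s, hs, rfl⟩, n, hn, rfl⟩
    obtain ⟨_, ⟨v, hv, rfl⟩, k, hk, rfl⟩ := Submodule.mem_sup.1 hn
    refine Submodule.mem_sup.2 ⟨T (s + v), ⟨s + v, hdual v hv s hs.1, rfl⟩, k, hk, ?_⟩
    rw [map_add, add_assoc]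
    rfl
  have hsup : ∀ B, (S : Set H) ∩ {q | w q < B} ⊆ T '' K B + (N' : Set H) := by
    rintro B q ⟨hq, hqB⟩
    obtain ⟨_, ⟨s, hs, rfl⟩, n, hn, rfl⟩ := Submodule.mem_sup.1 hq
    obtain ⟨u, hu, v, hv, rfl⟩ := V.exists_add_mem_mem_orthogonal s
    have hxv : ⟪x, v⟫ = 0 := hv x hxV
    have hus : u ∈ innerDual (C : Set E) := by
      have := hdual (-v) (neg_mem hv) _ hs
      rwa [add_neg_cancel_right] at this
    refine ⟨T u, ⟨u, ⟨hus, hu, ?_⟩, rfl⟩, T v + n,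
      Submodule.add_mem_sup ⟨v, hv, rfl⟩ hn, ?_⟩
    · have h1 : w (T (u + v) + n) < B := hqB
      rw [map_add, hwT, inner_add_right, hxv] at h1
      linarith [hwN n hn]
    · change T u + (T v + n) = T (u + v) + n
      rw [map_add, add_assoc]
  refine isClosed_of_closure_subset fun z hz => ?_
  -- Any bound above `w z` works: near `z` the sum is contained in a single closed set.
  refine hsub (w z + 1) ((hK _).closure_subset_iff.2 (hsup (w z + 1)) ?_)
  have hopen : IsOpen {q | w q < w z + 1} :=
    isOpen_lt w.continuous_of_finiteDimensional continuous_const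
  rw [Set.inter_comm]
  exact hopen.inter_closure ⟨lt_add_one (w z), hz⟩

/-- **Farkas' lemma** under a partial polyhedral Slater condition. -/
theorem mem_map_innerDual_sup (C : ProperCone ℝ E) (T : E →ₗ[ℝ] H) {N : PointedCone ℝ H}
    (hN : N.FG) {x : E} (hx : x ∈ intrinsicInterior ℝ (C : Set E)) (w : H →ₗ[ℝ] ℝ)
    (hwT : ∀ s, w (T s) = ⟪x, s⟫) (hwN : ∀ n ∈ N, 0 ≤ w n) {z : H}
    (hz : ∀ f : H →ₗ[ℝ] ℝ, (∀ s ∈ innerDual (C : Set E), 0 ≤ f (T s)) → (∀ n ∈ N, 0 ≤ f n) →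
      0 ≤ f z) :
    ∃ s ∈ innerDual (C : Set E), ∃ n ∈ N, T s + n = z := by
  let S : ProperCone ℝ H :=
    ⟨(innerDual (C : Set E)).toPointedCone.map T ⊔ N,
      C.isClosed_map_innerDual_sup T hN hx w hwT hwN⟩
  have hzS : z ∈ S := by
    by_contra hzS
    obtain ⟨f, hf, hfz⟩ := S.hyperplane_separation_point hzS
    refine hfz.not_ge (hz f (fun s hs => hf _ ?_) fun n hn => hf _ ?_)
    · exact Submodule.mem_sup_left (S := (innerDual (C : Set E)).toPointedCone.map T) ⟨s, hs, rfl⟩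
    · exact Submodule.mem_sup_right (T := N) hn
  obtain ⟨_, ⟨s, hs, rfl⟩, n, hn, h⟩ := Submodule.mem_sup.1 hzS
  exact ⟨s, hs, n, hn, h⟩

end Sum

end ProperCone

/-! ### Nonnegativity of functionals on sums, rays and images. -/

namespace PointedCone

variable {H : Type*} [AddCommGroup H] [Module ℝ H]

theorem forall_mem_sup_nonneg_iff {M N : PointedCone ℝ H} (f : H →ₗ[ℝ] ℝ) :
    (∀ n ∈ M ⊔ N, 0 ≤ f n) ↔ (∀ n ∈ M, 0 ≤ f n) ∧ ∀ n ∈ N, 0 ≤ f n := by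
  refine ⟨fun h => ⟨fun n hn => h n (Submodule.mem_sup_left hn),
    fun n hn => h n (Submodule.mem_sup_right hn)⟩, fun h n hn => ?_⟩
  obtain ⟨u, hu, v, hv, rfl⟩ := Submodule.mem_sup.1 hn
  rw [map_add]
  exact add_nonneg (h.1 u hu) (h.2 v hv)

theorem forall_mem_hull_singleton_nonneg_iff (a : H) (f : H →ₗ[ℝ] ℝ) :
    (∀ n ∈ hull ℝ {a}, 0 ≤ f n) ↔ 0 ≤ f a := by
  refine ⟨fun h => h a (Submodule.mem_span_singleton_self a), fun h n hn => ?_⟩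
  obtain ⟨τ, rfl⟩ := Submodule.mem_span_singleton.1 hn
  change 0 ≤ f ((τ : ℝ) • a)
  rw [map_smul]
  exact mul_nonneg τ.2 h

theorem forall_mem_map_nonneg_iff {H' : Type*} [AddCommGroup H'] [Module ℝ H']
    {N : PointedCone ℝ H'} (g : H' →ₗ[ℝ] H) (f : H →ₗ[ℝ] ℝ) :
    (∀ n ∈ N.map g, 0 ≤ f n) ↔ ∀ n ∈ N, 0 ≤ f (g n) := by
  simp [PointedCone.mem_map]

end PointedCone

namespace ConicLP

/-! ### Weak duality and optimality certificates. -/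

section WeakDuality

variable {E F : Type*} [NormedAddCommGroup E] [InnerProductSpace ℝ E] [FiniteDimensional ℝ E]
  [NormedAddCommGroup F] [InnerProductSpace ℝ F] [FiniteDimensional ℝ F] (P : ConicLP E F)

theorem inner_slack (y : F) (x : E) : ⟪P.slack y, x⟫ = ⟪P.c, x⟫ - ⟪y, P.A x⟫ := by
  rw [slack, inner_sub_left, LinearMap.adjoint_inner_left]

theorem inner_le_of_feasible {x : E} (hx : x ∈ P.primalFeasible) {y : F}
    (hy : y ∈ P.dualFeasible) : ⟪P.b, y⟫ ≤ ⟪P.c, x⟫ := by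
  have h : 0 ≤ ⟪P.slack y, x⟫ := hx.2 hy
  rw [inner_slack, hx.1, real_inner_comm _ y] at h
  linarith

theorem dualValue_le_primalValue : P.dualValue ≤ P.primalValue :=
  iSup₂_le fun _ hy => le_iInf₂ fun _ hx => EReal.coe_le_coe_iff.2 (P.inner_le_of_feasible hx hy)

/-- A dual feasible point whose value is at least the primal value is optimal. -/
theorem eq_and_dualAttained {y : F} (hy : y ∈ P.dualFeasible)
    (h : P.primalValue ≤ ((⟪P.b, y⟫ : ℝ) : EReal)) :
    P.primalValue = P.dualValue ∧ P.DualAttained := by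
  have h1 : ((⟪P.b, y⟫ : ℝ) : EReal) ≤ P.dualValue :=
    le_iSup₂ (f := fun y (_ : y ∈ P.dualFeasible) => ((⟪P.b, y⟫ : ℝ) : EReal)) y hy
  exact ⟨(h.trans h1).antisymm P.dualValue_le_primalValue, y, hy,
    h1.antisymm (P.dualValue_le_primalValue.trans h)⟩

/-- A primal feasible point whose value is at most the dual value is optimal. -/
theorem eq_and_primalAttained {x : E} (hx : x ∈ P.primalFeasible)
    (h : ((⟪P.c, x⟫ : ℝ) : EReal) ≤ P.dualValue) :
    P.primalValue = P.dualValue ∧ P.PrimalAttained := by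
  have h1 : P.primalValue ≤ ((⟪P.c, x⟫ : ℝ) : EReal) :=
    iInf₂_le (f := fun x (_ : x ∈ P.primalFeasible) => ((⟪P.c, x⟫ : ℝ) : EReal)) x hx
  exact ⟨(h1.trans h).antisymm P.dualValue_le_primalValue, x, hx,
    (h.trans P.dualValue_le_primalValue).antisymm h1⟩

end WeakDuality

/-! ### Homogenized feasible points. -/

section Homogenization

theorem nonneg_of_forall_le_add_mul {θ p q : ℝ} (h : ∀ l : ℝ, 0 ≤ l → θ ≤ p + l * q) : 0 ≤ q := by
  by_contra! hq
  -- This `l` makes the right-hand side `p - |θ - p| - 1`, which is below `θ`.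
  have h1 := h ((|θ - p| + 1) / -q) (div_nonneg (by positivity) (by linarith))
  have h2 : (|θ - p| + 1) / -q * q = -(|θ - p| + 1) := by
    rw [div_neg, neg_mul, div_mul_cancel₀ _ hq.ne]
  rw [h2] at h1
  linarith [neg_abs_le (θ - p)]

variable {E F : Type*} [NormedAddCommGroup E] [InnerProductSpace ℝ E] [FiniteDimensional ℝ E]
  [NormedAddCommGroup F] [InnerProductSpace ℝ F] [FiniteDimensional ℝ F] (P : ConicLP E F)

-- For `t > 0`, rescaling by `t⁻¹` gives a feasible point. For `t = 0`, `x` is a recession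
-- direction: `x₀ + l • x` is feasible for all `l ≥ 0`, so the lower bound `θ` forces `0 ≤ ⟪c, x⟫`.
-- This case is where a feasible point is needed.
omit [FiniteDimensional ℝ F] in
theorem le_inner_of_homogeneous_primal [CompleteSpace E] {θ : ℝ} (hθ : (θ : EReal) ≤ P.primalValue)
    {x₀ : E} (hx₀ : x₀ ∈ P.primalFeasible) {x : E} {t : ℝ} (ht : 0 ≤ t)
    (hx : x ∈ ProperCone.innerDual (P.K : Set E)) (hA : P.A x = t • P.b) :
    t * θ ≤ ⟪P.c, x⟫ := by
  have hle : ∀ x ∈ P.primalFeasible, θ ≤ ⟪P.c, x⟫ := fun x hx =>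
    EReal.coe_le_coe_iff.1 (hθ.trans
      (iInf₂_le (f := fun x (_ : x ∈ P.primalFeasible) => ((⟪P.c, x⟫ : ℝ) : EReal)) x hx))
  rcases ht.eq_or_lt with rfl | ht
  · rw [zero_mul]
    refine nonneg_of_forall_le_add_mul (θ := θ) (p := ⟪P.c, x₀⟫) fun l hl => ?_
    rw [← real_inner_smul_right, ← inner_add_right]
    refine hle _ ⟨?_, add_mem hx₀.2 (ProperCone.smul_mem _ hx hl)⟩
    rw [map_add, map_smul, hA, hx₀.1, zero_smul, smul_zero, add_zero]
  · have := hle (t⁻¹ • x) ⟨by rw [map_smul, hA, inv_smul_smul₀ ht.ne'],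
      ProperCone.smul_mem _ hx (inv_nonneg.2 ht.le)⟩
    rwa [real_inner_smul_right, ← div_eq_inv_mul, le_div_iff₀' ht] at this

theorem inner_le_of_homogeneous_dual {θ : ℝ} (hθ : P.dualValue ≤ θ)
    {y₀ : F} (hy₀ : y₀ ∈ P.dualFeasible) {y : F} {t : ℝ} (ht : 0 ≤ t)
    (hy : t • P.c - LinearMap.adjoint P.A y ∈ P.K) : ⟪P.b, y⟫ ≤ t * θ := by
  have hle : ∀ y ∈ P.dualFeasible, ⟪P.b, y⟫ ≤ θ := fun y hy =>
    EReal.coe_le_coe_iff.1 (le_trans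
      (le_iSup₂ (f := fun y (_ : y ∈ P.dualFeasible) => ((⟪P.b, y⟫ : ℝ) : EReal)) y hy) hθ)
  rcases ht.eq_or_lt with rfl | ht
  · rw [zero_mul, ← neg_nonneg]
    refine nonneg_of_forall_le_add_mul (θ := -θ) (p := -⟪P.b, y₀⟫) fun l hl => ?_
    have hmem : y₀ + l • y ∈ P.dualFeasible := by
      have := add_mem hy₀ (ProperCone.smul_mem _ hy hl)
      change P.slack _ ∈ P.K
      convert! this using 1
      rw [slack, slack, map_add, map_smul, zero_smul, zero_sub, smul_neg]
      abel
    have := hle _ hmem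
    rw [inner_add_right, real_inner_smul_right] at this
    linarith
  · have hmem : t⁻¹ • y ∈ P.dualFeasible := by
      have := ProperCone.smul_mem _ hy (inv_nonneg.2 ht.le)
      rwa [smul_sub, inv_smul_smul₀ ht.ne', ← map_smul] at this
    have := hle _ hmem
    rwa [real_inner_smul_right, ← div_eq_inv_mul, div_le_iff₀' ht] at this

end Homogenization

/-! ### Product cones and polyhedral blocks. -/

section Prod

variable {E₁ E₂ : Type*} [NormedAddCommGroup E₁] [InnerProductSpace ℝ E₁]
  [NormedAddCommGroup E₂] [InnerProductSpace ℝ E₂]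

/-- The isometric inclusion of the first factor. -/
def inFst : E₁ →ₗ[ℝ] WithLp 2 (E₁ × E₂) :=
  (WithLp.linearEquiv 2 ℝ (E₁ × E₂)).symm.toLinearMap ∘ₗ LinearMap.inl ℝ E₁ E₂

/-- The isometric inclusion of the second factor. -/
def inSnd : E₂ →ₗ[ℝ] WithLp 2 (E₁ × E₂) :=
  (WithLp.linearEquiv 2 ℝ (E₁ × E₂)).symm.toLinearMap ∘ₗ LinearMap.inr ℝ E₁ E₂

theorem inner_inFst (x : WithLp 2 (E₁ × E₂)) (s : E₁) : ⟪x, inFst s⟫ = ⟪x.fst, s⟫ := by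
  simp [inFst, WithLp.prod_inner_apply]

theorem inner_inSnd (x : WithLp 2 (E₁ × E₂)) (s : E₂) : ⟪x, inSnd s⟫ = ⟪x.snd, s⟫ := by
  simp [inSnd, WithLp.prod_inner_apply]

@[simp]
theorem inFst_fst (s : E₁) : (inFst s : WithLp 2 (E₁ × E₂)).fst = s := rfl

@[simp]
theorem inFst_snd (s : E₁) : (inFst s : WithLp 2 (E₁ × E₂)).snd = 0 := rfl

@[simp]
theorem inSnd_fst (s : E₂) : (inSnd s : WithLp 2 (E₁ × E₂)).fst = 0 := rfl

@[simp]
theorem inSnd_snd (s : E₂) : (inSnd s : WithLp 2 (E₁ × E₂)).snd = s := rfl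

theorem inFst_add_inSnd (s : E₁) (t : E₂) :
    (inFst s + inSnd t : WithLp 2 (E₁ × E₂)) = WithLp.toLp 2 (s, t) := by
  simp [inFst, inSnd, ← WithLp.toLp_add]

theorem mem_innerDual_prodCone [CompleteSpace E₁] [CompleteSpace E₂]
    (K₁ : ProperCone ℝ E₁) (K₂ : ProperCone ℝ E₂) (x : WithLp 2 (E₁ × E₂)) :
    x ∈ ProperCone.innerDual (prodCone K₁ K₂ : Set (WithLp 2 (E₁ × E₂))) ↔
      x.fst ∈ ProperCone.innerDual (K₁ : Set E₁) ∧ x.snd ∈ ProperCone.innerDual (K₂ : Set E₂) := by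
  constructor
  · intro h
    refine ⟨fun s hs => ?_, fun s hs => ?_⟩
    · have := h (show WithLp.toLp 2 (s, (0 : E₂)) ∈ prodCone K₁ K₂ from ⟨hs, K₂.zero_mem⟩)
      simpa [WithLp.prod_inner_apply] using this
    · have := h (show WithLp.toLp 2 ((0 : E₁), s) ∈ prodCone K₁ K₂ from ⟨K₁.zero_mem, hs⟩)
      simpa [WithLp.prod_inner_apply] using this
  · rintro ⟨h1, h2⟩ s ⟨hs1, hs2⟩
    have e1 := h1 hs1
    have e2 := h2 hs2
    change 0 ≤ ⟪s.fst, x.fst⟫ at e1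
    change 0 ≤ ⟪s.snd, x.snd⟫ at e2
    change 0 ≤ ⟪s, x⟫
    rw [WithLp.prod_inner_apply]
    exact add_nonneg e1 e2

/-- The vector representing the restriction of a functional on `E × ℝ` to `E`. -/
theorem exists_inner_eq {E : Type*} [NormedAddCommGroup E] [InnerProductSpace ℝ E]
    [FiniteDimensional ℝ E] (f : E × ℝ →ₗ[ℝ] ℝ) :
    ∃ x : E, ∀ s τ, f (s, τ) = ⟪x, s⟫ + τ * f (0, 1) := by
  have : CompleteSpace E := FiniteDimensional.complete ℝ E
  refine ⟨(InnerProductSpace.toDual ℝ E).symm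
    (LinearMap.toContinuousLinearMap (f ∘ₗ LinearMap.inl ℝ E ℝ)), fun s τ => ?_⟩
  rw [InnerProductSpace.toDual_symm_apply, ← smul_eq_mul, ← map_smul]
  simp [← map_add]

/-- Polyhedral cones are finitely generated. -/
theorem fg_of_isPolyhedralCone {E : Type*} [NormedAddCommGroup E] [InnerProductSpace ℝ E]
    [FiniteDimensional ℝ E] {K : ProperCone ℝ E} (hK : IsPolyhedralCone K) :
    K.toPointedCone.FG := by
  have : CompleteSpace E := FiniteDimensional.complete ℝ E
  obtain ⟨s, hs⟩ := hK
  rw [← hs]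
  exact ProperCone.fg_innerDual_of_finite s.finite_toSet

/-- The dual of a polyhedral cone is finitely generated. -/
theorem fg_innerDual_of_isPolyhedralCone {E : Type*} [NormedAddCommGroup E] [InnerProductSpace ℝ E]
    [FiniteDimensional ℝ E] [CompleteSpace E] {K : ProperCone ℝ E} (hK : IsPolyhedralCone K) :
    (ProperCone.innerDual (K : Set E)).toPointedCone.FG := by
  obtain ⟨s, hs⟩ := fg_of_isPolyhedralCone hK
  have : ProperCone.innerDual (K : Set E) = ProperCone.innerDual (s : Set E) := by
    have hK' : (K : Set E) = (PointedCone.hull ℝ (s : Set E) : Set E) := by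
      rw [PointedCone.hull, hs]; rfl
    rw [hK']
    ext y
    exact SetLike.ext_iff.1 (PointedCone.dual_hull (p := innerₗ E) (s : Set E)) y
  rw [this]
  exact ProperCone.fg_innerDual_of_finite s.finite_toSet

/-! ### Strong duality from Farkas' lemma. -/

variable [FiniteDimensional ℝ E₁] [FiniteDimensional ℝ E₂] {F : Type*} [NormedAddCommGroup F]
  [InnerProductSpace ℝ F] [FiniteDimensional ℝ F] (K₁ : ProperCone ℝ E₁) {K₂ : ProperCone ℝ E₂}
  (A : WithLp 2 (E₁ × E₂) →ₗ[ℝ] F) (b : F) (c : WithLp 2 (E₁ × E₂))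

/-- Strong duality with dual attainment under the primal partial polyhedral Slater condition. -/
theorem eq_and_dualAttained_of_primalPPS (hK₂ : IsPolyhedralCone K₂) {θ : ℝ}
    (hθ : (ofProd K₁ K₂ A b c).primalValue = θ) (h : (ofProd K₁ K₂ A b c).PrimalPPS K₁) :
    (ofProd K₁ K₂ A b c).primalValue = (ofProd K₁ K₂ A b c).dualValue ∧
      (ofProd K₁ K₂ A b c).DualAttained := by
  have : CompleteSpace E₁ := FiniteDimensional.complete ℝ E₁
  have : CompleteSpace E₂ := FiniteDimensional.complete ℝ E₂
  obtain ⟨x₀, hx₀, hri⟩ := h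
  have hx₀K := (mem_innerDual_prodCone K₁ K₂ x₀).1 hx₀.2
  have hAx₀ : A x₀ = b := hx₀.1
  let G : F →ₗ[ℝ] WithLp 2 (E₁ × E₂) × ℝ := (LinearMap.adjoint A).prod (innerₗ F b)
  let T : E₁ →ₗ[ℝ] WithLp 2 (E₁ × E₂) × ℝ := LinearMap.inl ℝ _ _ ∘ₗ inFst
  let U : E₂ →ₗ[ℝ] WithLp 2 (E₁ × E₂) × ℝ := LinearMap.inl ℝ _ _ ∘ₗ inSnd
  -- The range of `G` is a subspace, so nonnegative functionals vanish on it, which encodes `A x = t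
  -- • b`. The ray relaxes the target value to `θ ≤ ⟪b, y⟫`.
  let N : PointedCone ℝ (WithLp 2 (E₁ × E₂) × ℝ) :=
    ((⊤ : Submodule ℝ F) : PointedCone ℝ F).map G ⊔ K₂.toPointedCone.map U ⊔
      PointedCone.hull ℝ {(0, -1)}
  have hN : N.FG :=
    ((PointedCone.fg_map (PointedCone.fg_ofSubmodule _) G).sup
      (PointedCone.fg_map (fg_of_isPolyhedralCone hK₂) U)).sup (Submodule.fg_span_singleton _)
  -- As `A x₀ = b`, this functional vanishes on the range of `G`.
  let w : WithLp 2 (E₁ × E₂) × ℝ →ₗ[ℝ] ℝ :=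
    innerₗ _ x₀ ∘ₗ LinearMap.fst ℝ _ _ - LinearMap.snd ℝ _ _
  have hmemN : ∀ f : WithLp 2 (E₁ × E₂) × ℝ →ₗ[ℝ] ℝ, (∀ n ∈ N, 0 ≤ f n) ↔
      (∀ y, 0 ≤ f (G y)) ∧ (∀ s ∈ K₂, 0 ≤ f (U s)) ∧ 0 ≤ f (0, -1) := by
    intro f
    rw [PointedCone.forall_mem_sup_nonneg_iff, PointedCone.forall_mem_sup_nonneg_iff,
      PointedCone.forall_mem_map_nonneg_iff, PointedCone.forall_mem_map_nonneg_iff,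
      PointedCone.forall_mem_hull_singleton_nonneg_iff, and_assoc]
    exact and_congr_left' ⟨fun h y => h y trivial, fun h y _ => h y⟩
  have hwN : ∀ n ∈ N, 0 ≤ w n := by
    refine (hmemN w).2 ⟨fun y => ?_, fun s hs => ?_, ?_⟩
    · simp [w, G, LinearMap.adjoint_inner_right, hAx₀]
    · have := hx₀K.2 hs
      change 0 ≤ ⟪s, x₀.snd⟫ at this
      simpa [w, U, inner_inSnd, real_inner_comm] using this
    · simp [w]
  obtain ⟨s₁, hs₁, n, hn, hsum⟩ := (ProperCone.innerDual (K₁ : Set E₁)).mem_map_innerDual_sup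
    T hN hri w (fun s => by simp [w, T]) hwN (z := (c, θ)) (by
      intro f hfT hfN
      rw [ProperCone.innerDual_innerDual] at hfT
      obtain ⟨hG, hU, h1⟩ := (hmemN f).1 hfN
      obtain ⟨x, hx⟩ := exists_inner_eq f
      have ht : 0 ≤ -f (0, 1) := by
        simpa [hx 0 (-1)] using h1
      -- The functional is `(x, -t)` with `t = -f (0, 1)`, a homogenized primal point.
      have key := (ofProd K₁ K₂ A b c).le_inner_of_homogeneous_primal hθ.ge hx₀ (x := x) ht
        ((mem_innerDual_prodCone K₁ K₂ x).2 ⟨fun s hs => ?_, fun s hs => ?_⟩) ?_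
      · rw [hx]
        change _ ≤ ⟪c, x⟫ at key
        rw [real_inner_comm]
        linarith
      · have := hfT s hs
        change 0 ≤ f (inFst s, 0) at this
        rwa [hx, zero_mul, add_zero, inner_inFst, real_inner_comm] at this
      · have := hU s hs
        change 0 ≤ f (inSnd s, 0) at this
        rwa [hx, zero_mul, add_zero, inner_inSnd, real_inner_comm] at this
      · change A x = _ • b
        refine ext_inner_right ℝ fun y => ?_
        have e1 := hG y
        have e2 := hG (-y)
        rw [map_neg, map_neg] at e2
        have e3 : f (G y) = ⟪A x, y⟫ + ⟪b, y⟫ * f (0, 1) := by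
          change f (LinearMap.adjoint A y, ⟪b, y⟫) = _
          rw [hx, LinearMap.adjoint_inner_right]
        rw [real_inner_smul_left]
        linarith)
  rw [ProperCone.innerDual_innerDual] at hs₁
  obtain ⟨n', hn', _, hr, rfl⟩ := Submodule.mem_sup.1 hn
  obtain ⟨_, ⟨y, -, rfl⟩, _, ⟨s₂, hs₂, rfl⟩, rfl⟩ := Submodule.mem_sup.1 hn'
  obtain ⟨τ, rfl⟩ := Submodule.mem_span_singleton.1 hr
  have hsum1 := congrArg Prod.fst hsum
  have hsum2 := congrArg Prod.snd hsum
  change inFst s₁ + (LinearMap.adjoint A y + inSnd s₂ + (τ : ℝ) • (0 : WithLp 2 (E₁ × E₂))) = c at hsum1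
  change 0 + (⟪b, y⟫ + 0 + (τ : ℝ) • (-1 : ℝ)) = θ at hsum2
  refine eq_and_dualAttained _ (y := y) ?_ ?_
  · have : (ofProd K₁ K₂ A b c).slack y = WithLp.toLp 2 (s₁, s₂) := by
      change c - LinearMap.adjoint A y = _
      rw [← inFst_add_inSnd, ← hsum1, smul_zero]
      abel
    change (ofProd K₁ K₂ A b c).slack y ∈ prodCone K₁ K₂
    rw [this]
    exact ⟨hs₁, hs₂⟩
  · rw [hθ, EReal.coe_le_coe_iff]
    change θ ≤ ⟪b, y⟫
    have := τ.2
    rw [smul_eq_mul] at hsum2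
    linarith

/-- Strong duality with primal attainment under the dual partial polyhedral Slater condition. -/
theorem eq_and_primalAttained_of_dualPPS (hK₂ : IsPolyhedralCone K₂) {θ : ℝ}
    (hθ : (ofProd K₁ K₂ A b c).dualValue = θ) (h : (ofProd K₁ K₂ A b c).DualPPS K₁ K₂) :
    (ofProd K₁ K₂ A b c).primalValue = (ofProd K₁ K₂ A b c).dualValue ∧
      (ofProd K₁ K₂ A b c).PrimalAttained := by
  have : CompleteSpace E₁ := FiniteDimensional.complete ℝ E₁
  have : CompleteSpace E₂ := FiniteDimensional.complete ℝ E₂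
  obtain ⟨y₀, hri, hy₀⟩ := h
  have hfeas : y₀ ∈ (ofProd K₁ K₂ A b c).dualFeasible := ⟨intrinsicInterior_subset hri, hy₀⟩
  have hslack : ∀ x, ⟪c, x⟫ - ⟪y₀, A x⟫ = ⟪(ofProd K₁ K₂ A b c).slack y₀, x⟫ := fun x =>
    (inner_slack (ofProd K₁ K₂ A b c) y₀ x).symm
  let L : WithLp 2 (E₁ × E₂) →ₗ[ℝ] F × ℝ := A.prod (innerₗ _ c)
  let T : E₁ →ₗ[ℝ] F × ℝ := L ∘ₗ inFst
  let U : E₂ →ₗ[ℝ] F × ℝ := L ∘ₗ inSnd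
  let N : PointedCone ℝ (F × ℝ) :=
    (ProperCone.innerDual (K₂ : Set E₂)).toPointedCone.map U ⊔ PointedCone.hull ℝ {(0, 1)}
  have hN : N.FG :=
    (PointedCone.fg_map (fg_innerDual_of_isPolyhedralCone hK₂) U).sup
      (Submodule.fg_span_singleton _)
  have hmemN : ∀ f : F × ℝ →ₗ[ℝ] ℝ, (∀ n ∈ N, 0 ≤ f n) ↔
      (∀ s ∈ ProperCone.innerDual (K₂ : Set E₂), 0 ≤ f (U s)) ∧ 0 ≤ f (0, 1) := by
    intro f
    rw [PointedCone.forall_mem_sup_nonneg_iff, PointedCone.forall_mem_map_nonneg_iff,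
      PointedCone.forall_mem_hull_singleton_nonneg_iff]
    rfl
  -- Composed with `L`, this is pairing with the slack at `y₀`.
  let w : F × ℝ →ₗ[ℝ] ℝ := LinearMap.snd ℝ _ _ - innerₗ _ y₀ ∘ₗ LinearMap.fst ℝ _ _
  have hwN : ∀ n ∈ N, 0 ≤ w n := by
    refine (hmemN w).2 ⟨fun s hs => ?_, ?_⟩
    · have : w (U s) = ⟪((ofProd K₁ K₂ A b c).slack y₀).snd, s⟫ :=
        (hslack (inSnd s)).trans (inner_inSnd _ s)
      rw [this]
      exact hs hy₀
    · simp [w]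
  obtain ⟨x₁, hx₁, n, hn, hsum⟩ := K₁.mem_map_innerDual_sup
    T hN hri w (fun s => (hslack (inFst s)).trans (inner_inFst _ s)) hwN (z := (b, θ)) (by
      intro f hfT hfN
      obtain ⟨hU, h1⟩ := (hmemN f).1 hfN
      obtain ⟨y, hy⟩ := exists_inner_eq f
      have hfL : ∀ x, f (L x) = ⟪f (0, 1) • c - LinearMap.adjoint A (-y), x⟫ := fun x => by
        change f (A x, ⟪c, x⟫) = _
        rw [hy, inner_sub_left, real_inner_smul_left, LinearMap.adjoint_inner_left, inner_neg_left]
        ring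
      -- Here `f` encodes the homogenized dual point `-y` with scale `t = f (0, 1)`.
      have key := (ofProd K₁ K₂ A b c).inner_le_of_homogeneous_dual hθ.le hfeas (y := -y) h1 (by
        refine ⟨?_, ?_⟩
        · rw [← ProperCone.innerDual_innerDual K₁]
          intro s hs
          have := hfT s hs
          change 0 ≤ f (L _) at this
          rw [hfL, inner_inFst] at this
          rw [real_inner_comm] at this
          exact this
        · rw [← ProperCone.innerDual_innerDual K₂]
          intro s hs
          have := hU s hs
          change 0 ≤ f (L _) at this
          rw [hfL, inner_inSnd] at this
          rw [real_inner_comm] at this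
          exact this)
      change ⟪b, -y⟫ ≤ _ at key
      rw [inner_neg_right, real_inner_comm] at key
      rw [hy]
      linarith)
  obtain ⟨_, ⟨x₂, hx₂, rfl⟩, _, hr, rfl⟩ := Submodule.mem_sup.1 hn
  obtain ⟨τ, rfl⟩ := Submodule.mem_span_singleton.1 hr
  have hsum' : L (inFst x₁ + inSnd x₂) + (τ : ℝ) • ((0, 1) : F × ℝ) = (b, θ) := by
    rw [map_add, add_assoc]
    exact hsum
  have hsum1 : A (inFst x₁ + inSnd x₂) + (τ : ℝ) • (0 : F) = b := congrArg Prod.fst hsum'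
  have hsum2 : ⟪c, inFst x₁ + inSnd x₂⟫ + (τ : ℝ) • (1 : ℝ) = θ := congrArg Prod.snd hsum'
  refine eq_and_primalAttained _ (x := inFst x₁ + inSnd x₂) ⟨?_, ?_⟩ ?_
  · rwa [smul_zero, add_zero] at hsum1
  · rw [inFst_add_inSnd]
    exact (mem_innerDual_prodCone K₁ K₂ _).2 ⟨hx₁, hx₂⟩
  · rw [hθ, EReal.coe_le_coe_iff]
    change ⟪c, _⟫ ≤ θ
    have := τ.2
    rw [smul_eq_mul] at hsum2
    linarith

end Prod

end ConicLP

theorem mainTheorem3 (n₁ n₂ m : ℕ)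
    (K₁ : ProperCone ℝ (EuclideanSpace ℝ (Fin n₁)))
    (K₂ : ProperCone ℝ (EuclideanSpace ℝ (Fin n₂)))
    (hK₂ : IsPolyhedralCone K₂)
    (A : WithLp 2 (EuclideanSpace ℝ (Fin n₁) × EuclideanSpace ℝ (Fin n₂)) →ₗ[ℝ]
      EuclideanSpace ℝ (Fin m))
    (b : EuclideanSpace ℝ (Fin m))
    (c : WithLp 2 (EuclideanSpace ℝ (Fin n₁) × EuclideanSpace ℝ (Fin n₂))) :
    ((∃ r : ℝ, (ConicLP.ofProd K₁ K₂ A b c).primalValue = (r : EReal)) →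
      (ConicLP.ofProd K₁ K₂ A b c).PrimalPPS K₁ →
        (ConicLP.ofProd K₁ K₂ A b c).primalValue = (ConicLP.ofProd K₁ K₂ A b c).dualValue ∧
          (ConicLP.ofProd K₁ K₂ A b c).DualAttained) ∧
    ((∃ r : ℝ, (ConicLP.ofProd K₁ K₂ A b c).dualValue = (r : EReal)) →
      (ConicLP.ofProd K₁ K₂ A b c).DualPPS K₁ K₂ →
        (ConicLP.ofProd K₁ K₂ A b c).primalValue = (ConicLP.ofProd K₁ K₂ A b c).dualValue ∧
          (ConicLP.ofProd K₁ K₂ A b c).PrimalAttained) := by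
  refine ⟨?_, ?_⟩
  · rintro ⟨r, hr⟩ h
    exact ConicLP.eq_and_dualAttained_of_primalPPS K₁ A b c hK₂ hr h
  · rintro ⟨r, hr⟩ h
    exact ConicLP.eq_and_primalAttained_of_dualPPS K₁ A b c hK₂ hr h
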